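/- A \emph{biquandle} is a set $X$ with operations $\underline{\triangleright},\overline{\triangleright}:X\times X\to X$ such that for all $x,y,z\in X$: (i) $x\,\underline{\triangleright}\,x=x\,\overline{\triangleright}\,x$; (ii) the maps $x\mapsto x\,\overline{\triangleright}\,y$, $x\mapsto x\,\underline{\triangleright}\,y$ and $(x,y)\mapsto(y\,\overline{\triangleright}\,x,\;x\,\underline{\triangleright}\,y)$ are bijective; (iii) $(x\,\underline{\triangleright}\,y)\,\underline{\triangleright}\,(z\,\underline{\triangleright}\,y)=(x\,\underline{\triangleright}\,z)\,\underline{\triangleright}\,(y\,\overline{\triangleright}\,z)$, $(x\,\underline{\triangleright}\,y)\,\overline{\triangleright}\,(z\,\underline{\triangleright}\,y)=(x\,\overline{\triangleright}\,z)\,\underline{\triangleright}\,(y\,\overline{\triangleright}\,z)$, $(x\,\overline{\triangleright}\,y)\,\overline{\triangleright}\,(z\,\overline{\triangleright}\,y)=(x\,\overline{\triangleright}\,z)\,\overline{\triangleright}\,(y\,\underline{\triangleright}\,z)$. A \emph{psyquandle} is a biquandle $X$ with two further operations $\underline{\bullet},\overline{\bullet}:X\times X\to X$ such that for all $x,y,z\in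 X$: the maps $x\mapsto x\,\overline{\bullet}\,y$, $x\mapsto x\,\underline{\bullet}\,y$ and $(x,y)\mapsto(y\,\overline{\bullet}\,x,\;x\,\underline{\bullet}\,y)$ are bijective; there are unique $w,z\in X$ with $x\,\underline{\triangleright}\,y=z\,\overline{\bullet}\,y$, $y\,\overline{\triangleright}\,x=w\,\overline{\bullet}\,x$, $w\,\underline{\triangleright}\,z=y\,\underline{\bullet}\,z$, $z\,\overline{\triangleright}\,w=x\,\underline{\bullet}\,w$; and $$\begin{array}{ll} (x\,\overline{\triangleright}\,y)\,\overline{\triangleright}\,(z\,\overline{\bullet}\,y)=(x\,\overline{\triangleright}\,z)\,\overline{\triangleright}\,(y\,\underline{\bullet}\,z), & (x\,\underline{\triangleright}\,y)\,\underline{\triangleright}\,(z\,\overline{\bullet}\,y)=(x\,\underline{\triangleright}\,z)\,\underline{\triangleright}\,(y\,\underline{\bullet}\,z),\\ (x\,\overline{\triangleright}\,y)\,\overline{\bullet}\,(z\,\overline{\triangleright}\,y)=(x\,\overline{\bullet}\,z)\,\overline{\triangleright}\,(y\,\underline{\triangleright}\,z), & (x\,\underline{\triangleright}\,y)\,\underline{\bullet}\,(z\,\underline{\triangleright}\,y)=(x\,\underline{\bullet}\,z)\,\underline{\triangleright}\,(y\,\overline{\triangleright}\,z),\\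 (x\,\overline{\triangleright}\,y)\,\underline{\bullet}\,(z\,\overline{\triangleright}\,y)=(x\,\underline{\bullet}\,z)\,\overline{\triangleright}\,(y\,\underline{\triangleright}\,z), & (x\,\underline{\triangleright}\,y)\,\overline{\bullet}\,(z\,\underline{\triangleright}\,y)=(x\,\overline{\bullet}\,z)\,\underline{\triangleright}\,(y\,\overline{\triangleright}\,z). \end{array}$$ It is \emph{pI-adequate} if $x\,\underline{\bullet}\,x=x\,\overline{\bullet}\,x$ for all $x\in X$. Consider oriented link diagrams with positive and negative classical crossings and undecorated double points; the double points are read as singular crossings (oriented singular link diagrams) or as precrossings (oriented pseudolink diagrams). An \emph{$X$-coloring} of a diagram assigns an element of $X$ to each semiarc so that the following holds at each crossing, drawn with both strands directed upward. Each strand has one end on the left and one end on the right of the crossing. At a classical crossing, if the under-strand and the over-strand have the left colors $x$ and $y$, then they have the right colors $x\,\underline{\triangleright}\,y$ and $y\,\overline{\triangleright}\,x$, respectively. At a double point, if the strand from bottom right to top left and the strand from bottom left to top right have the left colors $x$ and $y$, then they have the right colors $x\,\underline{\bullet}\,y$ and $y\,\overline{\bullet}\,x$, respectively. The \emph{singular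 Reidemeister moves} are, with all choices of orientations, the classical Reidemeister moves I, II, III; the move sliding a classical crossing of two strands through an adjacent double point of the same two strands; and the move of a strand over or under a double point of two other strands. The \emph{pseudo Reidemeister moves} are these moves (with precrossings as double points) together with the move pI, which adds or removes a kink whose crossing is a precrossing. \emph{Oriented singular links} (respectively, \emph{oriented pseudolinks}) are diagrams up to the equivalence relation generated by planar isotopy and the singular (respectively, pseudo) Reidemeister moves. \textbf{Theorem.} Let $X$ be a finite psyquandle. The number of $X$-colorings of an oriented singular link diagram is not changed by singular Reidemeister moves. If $X$ is pI-adequate, then the number of $X$-colorings of an oriented pseudolink diagram is not changed by pseudo Reidemeister moves. Hence in each case there is a unique well-defined integer-valued invariant $\Phi_X^{\mathbb Z}(L)$ of oriented singular links (respectively, of oriented pseudolinks) whose value at $L$ is the number of $X$-colorings of every diagram of $L$. -/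

import Mathlib

/-! ### Biquandles and psyquandles -/

/-- A biquandle: `utri x y` is `x ▷̲ y` and `otri x y` is `x ▷̄ y`. -/
class Biquandle (X : Type*) where
  utri : X → X → X
  otri : X → X → X
  diag : ∀ x, utri x x = otri x x
  otri_bijective : ∀ y, Function.Bijective (fun x => otri x y)
  utri_bijective : ∀ y, Function.Bijective (fun x => utri x y)
  switch_bijective : Function.Bijective (fun p : X × X => (otri p.2 p.1, utri p.1 p.2))
  exchange_utri_utri : ∀ x y z,
    utri (utri x y) (utri z y) = utri (utri x z) (otri y z)
  exchange_utri_otri : ∀ x y z,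
    otri (utri x y) (utri z y) = utri (otri x z) (otri y z)
  exchange_otri_otri : ∀ x y z,
    otri (otri x y) (otri z y) = otri (otri x z) (utri y z)

open Biquandle in
/-- A psyquandle: a biquandle with two more operations, `udot x y` (written `x •̲ y`) and
`odot x y` (written `x •̄ y`). -/
class Psyquandle (X : Type*) extends Biquandle X where
  udot : X → X → X
  odot : X → X → X
  odot_bijective : ∀ y, Function.Bijective (fun x => odot x y)
  udot_bijective : ∀ y, Function.Bijective (fun x => udot x y)
  bswitch_bijective : Function.Bijective (fun p : X × X => (odot p.2 p.1, udot p.1 p.2))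
  /-- For all `x, y` there is a unique pair `(w, z)` with the four listed equations. -/
  existsUnique_pair : ∀ x y, ∃! p : X × X,
    utri x y = odot p.2 y ∧ otri y x = odot p.1 x ∧
    utri p.1 p.2 = udot y p.2 ∧ otri p.2 p.1 = udot x p.1
  mixed_otri : ∀ x y z,
    otri (otri x y) (odot z y) = otri (otri x z) (udot y z)
  mixed_utri : ∀ x y z,
    utri (utri x y) (odot z y) = utri (utri x z) (udot y z)
  mixed_otri_odot : ∀ x y z,
    odot (otri x y) (otri z y) = otri (odot x z) (utri y z)
  mixed_utri_udot : ∀ x y z,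
    udot (utri x y) (utri z y) = utri (udot x z) (otri y z)
  mixed_otri_udot : ∀ x y z,
    udot (otri x y) (otri z y) = otri (udot x z) (utri y z)
  mixed_utri_odot : ∀ x y z,
    odot (utri x y) (utri z y) = utri (odot x z) (otri y z)

/-- pI-adequacy: `x •̲ x = x •̄ x` for all `x`. -/
def Psyquandle.IsPIAdequate (X : Type*) [Psyquandle X] : Prop :=
  ∀ x : X, Psyquandle.udot x x = Psyquandle.odot x x

namespace SingularLink

/-! ### Crossings -/

/-- The type of a crossing. A `double` crossing is an undecorated transverse self-intersection:
a singular crossing of a singular link diagram, or a precrossing of a pseudolink diagram. -/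
inductive Kind
  | pos
  | neg
  | double

/-- Left or right, for a crossing drawn with both of its strands directed upward. -/
inductive Side
  | left
  | right

/-- An oriented crossing, whose four ends are labelled by elements of `A` (semiarcs or colours).
Draw it with both strands directed upward. Then `inL`, `inR` are the labels of the incoming
ends, at the bottom left and bottom right, and `outL`, `outR` are those of the outgoing ends,
at the top left and top right. One strand runs from `inL` to `outR`, the other from `inR`
to `outL`. The first one is the over-strand if the crossing is positive, and the under-strand
if it is negative. -/
structure Node (A : Type*) where
  kind : Kind
  inL : A
  inR : A
  outL : A
  outR : A

namespace Node

variable {A B X : Type*}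

def map (f : A → B) (c : Node A) : Node B :=
  ⟨c.kind, f c.inL, f c.inR, f c.outL, f c.outR⟩

def inc (c : Node A) : Side → A
  | .left => c.inL
  | .right => c.inR

def out (c : Node A) : Side → A
  | .left => c.outL
  | .right => c.outR

/-- The colouring rule at a crossing whose ends carry the colours in `c`. Each strand has one end
on the left (bottom left or top left) and one end on the right of the crossing. If `x` and `y`
are the left colours of the under-strand and of the over-strand of a classical crossing, then
their right colours are `x ▷̲ y` and `y ▷̄ x`. At a double point, if `y` and `x` are the left
colours of the strands from `inL` to `outR` and from `inR` to `outL`, then their right colours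
are `y •̄ x` and `x •̲ y`. -/
def IsColored [Psyquandle X] (c : Node X) : Prop :=
  match c.kind with
  | .pos => c.inR = Biquandle.utri c.outL c.inL ∧ c.outR = Biquandle.otri c.inL c.outL
  | .neg => c.outR = Biquandle.utri c.inL c.outL ∧ c.inR = Biquandle.otri c.outL c.inL
  | .double => c.inR = Psyquandle.udot c.outL c.inL ∧ c.outR = Psyquandle.odot c.inL c.outL

end Node

/-! ### Diagrams and pieces of diagrams -/

/-- A piece of a diagram with `n` numbered boundary points: finitely many crossings, finitely
many (semi)arcs, the arcs at the four ends of each crossing, and the arc at each boundary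
point. An arc at no crossing and at no boundary point is a closed circle without crossings. -/
structure Fragment (n : ℕ) where
  Crossing : Type
  Arc : Type
  finite_crossing : Finite Crossing
  finite_arc : Finite Arc
  node : Crossing → Node Arc
  bdry : Fin n → Arc

/-- The four corners at a crossing drawn with both strands directed upward. -/
inductive Corner
  | bottom
  | right
  | top
  | left

namespace Corner

/-- The corner on the left of the outgoing end at `s`. -/
def leftOfOut : Side → Corner
  | .left => .left
  | .right => .top

/-- The corner on the right of the outgoing end at `s`. -/
def rightOfOut : Side → Corner
  | .left => .top
  | .right => .right

/-- The corner on the left of the incoming end at `s`. -/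
def leftOfIn : Side → Corner
  | .left => .left
  | .right => .bottom

/-- The corner on the right of the incoming end at `s`. -/
def rightOfIn : Side → Corner
  | .left => .bottom
  | .right => .right

end Corner

namespace Fragment

variable {n : ℕ}

/-- Two crossings are joined by an arc from the first to the second. -/
def Joined (F : Fragment n) (c d : F.Crossing) : Prop :=
  ∃ s t : Side, (F.node c).out s = (F.node d).inc t

/-- The connected components that contain a crossing. -/
def Component (F : Fragment n) : Type :=
  Quot F.Joined

/-- Two corners lie on the same side of an arc that runs from the first crossing to the
second. -/
def CornerAdj (F : Fragment n) (p q : F.Crossing × Corner) : Prop :=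
  ∃ s t : Side, (F.node p.1).out s = (F.node q.1).inc t ∧
    ((p.2 = Corner.leftOfOut s ∧ q.2 = Corner.leftOfIn t) ∨
      (p.2 = Corner.rightOfOut s ∧ q.2 = Corner.rightOfIn t))

/-- The faces, each component that contains a crossing being drawn on a surface of its own. -/
def Face (F : Fragment n) : Type :=
  Quot F.CornerAdj

/-- The rule of a closed oriented diagram: no arc has two initial or two terminal ends at
crossings, and it has an initial one if and only if it has a terminal one. -/
structure IsClosed (F : Fragment n) : Prop where
  out_injective : Function.Injective (fun p : F.Crossing × Side => (F.node p.1).out p.2)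
  inc_injective : Function.Injective (fun p : F.Crossing × Side => (F.node p.1).inc p.2)
  range_eq : Set.range (fun p : F.Crossing × Side => (F.node p.1).out p.2) =
    Set.range (fun p : F.Crossing × Side => (F.node p.1).inc p.2)

/-- Planarity, by Euler's formula: a closed diagram with `v` crossings has `2 * v` semiarcs that
meet crossings, so all of its components lie in spheres if and only if it has `v + 2 * c` faces,
where `c` is the number of components that contain a crossing. -/
def IsPlanar (F : Fragment n) : Prop :=
  Nat.card F.Face = Nat.card F.Crossing + 2 * Nat.card F.Component

/-- An isomorphism of pieces of diagrams: a renaming of crossings and arcs. -/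
structure Iso (F G : Fragment n) where
  crossing : F.Crossing ≃ G.Crossing
  arc : F.Arc ≃ G.Arc
  node_eq : ∀ c, G.node (crossing c) = (F.node c).map arc
  bdry_eq : ∀ i, G.bdry i = arc (F.bdry i)

/-- Arcs of two pieces that are to be joined at a boundary point. -/
def GlueRel (T C : Fragment n) (a b : T.Arc ⊕ C.Arc) : Prop :=
  ∃ i : Fin n, a = Sum.inl (T.bdry i) ∧ b = Sum.inr (C.bdry i)

/-- The result of gluing two pieces along their boundary points. -/
def glue (T C : Fragment n) : Fragment 0 where
  Crossing := T.Crossing ⊕ C.Crossing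
  Arc := Quot (GlueRel T C)
  finite_crossing :=
    have := T.finite_crossing
    have := C.finite_crossing
    inferInstance
  finite_arc :=
    have := T.finite_arc
    have := C.finite_arc
    inferInstance
  node := Sum.elim
    (fun c => (T.node c).map (fun a => Quot.mk _ (Sum.inl a)))
    (fun c => (C.node c).map (fun a => Quot.mk _ (Sum.inr a)))
  bdry := Fin.elim0

/-- A piece with `k` crossings and `m` arcs, given by explicit tables. -/
def ofTable (m k : ℕ) (node : Fin k → Node (Fin m)) (bdry : Fin n → Fin m) : Fragment n where
  Crossing := Fin k
  Arc := Fin m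
  finite_crossing := inferInstance
  finite_arc := inferInstance
  node := node
  bdry := bdry

end Fragment

/-- An oriented link diagram with classical crossings and double points, in the sphere, as a
combinatorial 4-valent planar map with crossing data. Read the double points as singular crossings
for an oriented singular link diagram, and as precrossings for an oriented pseudolink diagram. -/
structure Diagram extends Fragment 0 where
  isClosed : toFragment.IsClosed
  isPlanar : toFragment.IsPlanar

/-- An `X`-colouring of a diagram: elements of `X` at the semiarcs that obey the colouring rule at
every crossing. -/
def Diagram.Coloring (X : Type*) [Psyquandle X] (D : Diagram) : Type _ :=
  {f : D.Arc → X // ∀ c : D.Crossing, ((D.node c).map f).IsColored}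

/-- The number of `X`-colourings (for finite `X` there are finitely many). -/
noncomputable def Diagram.numColorings (X : Type*) [Psyquandle X] (D : Diagram) : ℕ :=
  Nat.card (D.Coloring X)

/-! ### Reidemeister moves -/

/-- How one strand meets another: it passes over it, it passes under it, or the strands meet in a
double point. -/
inductive Pass
  | above
  | below
  | flat

namespace Pass

/-- The same meeting as seen from the other strand. -/
def swap : Pass → Pass
  | above => below
  | below => above
  | flat => flat

/-- The type of a crossing whose strand from `inL` to `outR` meets the other one as given. -/
def kind : Pass → Kind
  | above => .pos
  | below => .neg
  | flat => .double

/-- How a strand at height `h` meets one at height `h'`. Strands at the same height meet in a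
double point. -/
def ofHeights (h h' : ℕ) : Pass :=
  if h = h' then flat else if h' < h then above else below

end Pass

/-- The crossing of a first strand with ends `a`, `a'` and a second strand with ends `b`, `b'`,
where the four ends are `a, b, a', b'` in counterclockwise order. The first strand is directed
from `a` to `a'` if `r = false` and from `a'` to `a` if `r = true`, and similarly for the second
strand and `s`. The first strand meets the second one as `p` says. -/
def Node.meet {A : Type*} (p : Pass) (r s : Bool) (a b a' b' : A) : Node A :=
  match r, s with
  | false, false => { kind := p.kind, inL := a, inR := b, outR := a', outL := b' }
  | false, true => { kind := p.swap.kind, inL := b', inR := a, outR := b, outL := a' }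
  | true, false => { kind := p.swap.kind, inL := b, inR := a', outR := b', outL := a }
  | true, true => { kind := p.kind, inL := a', inR := b', outR := a, outL := b }

open Fragment

/-- One strand without crossings. -/
def strand : Fragment 2 :=
  ofTable 1 0 ![] ![0, 0]

/-- A strand with a kink on the right: it enters at `inL`, leaves at `outR`, comes back to `inR`
and leaves at `outL`. -/
def kinkRight (k : Kind) : Fragment 2 :=
  ofTable 3 1 ![{ kind := k, inL := 0, outR := 1, inR := 1, outL := 2 }] ![0, 2]

/-- A strand with a kink on the left. -/
def kinkLeft (k : Kind) : Fragment 2 :=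
  ofTable 3 1 ![{ kind := k, inR := 0, outL := 1, inL := 1, outR := 2 }] ![0, 2]

/-- Two disjoint vertical strands. The boundary points of this piece and of the next one are
numbered bottom left, bottom right, top left, top right. -/
def twoStrands : Fragment 4 :=
  ofTable 2 0 ![] ![0, 1, 0, 1]

/-- Two vertical strands that meet twice. The strand that starts at the bottom left (arcs
`0, 2, 4`) crosses the other one (arcs `1, 3, 5`) to the right and then crosses back.
At the lower crossing the strand from bottom left to top right meets the other one as `p` says,
and at the upper crossing the strand from bottom left to top right meets the other one as `q`
says. (These are different strands.) The strand starting at the bottom left is directed upward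
if `r = false`, and downward if `r = true`; similarly for the other one and `s`. -/
def twist (p q : Pass) (r s : Bool) : Fragment 4 :=
  ofTable 6 2 ![Node.meet p r s 0 1 2 3, Node.meet q s r 3 2 5 4] ![0, 1, 4, 5]

/-- Three straight strands in general position in a disc, with the boundary points `0, …, 5` in
counterclockwise order. Strand `i` joins the points `i` and `i + 3`, at the height `h i`, and
it is directed from `i` to `i + 3` if `r i = false`, and from `i + 3` to `i` if `r i = true`.
Starting from point `i`, the strand `0` meets `1`, then `2`; the strand `1` meets `0`,
then `2`; and the strand `2` meets `0`, then `1`. The arcs of strand `i` are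
`i`, `i + 3`, `i + 6`. -/
def triangle (h : Fin 3 → ℕ) (r : Fin 3 → Bool) : Fragment 6 :=
  ofTable 9 3
    ![Node.meet (Pass.ofHeights (h 0) (h 1)) (r 0) (r 1) 0 1 3 4,
      Node.meet (Pass.ofHeights (h 0) (h 2)) (r 0) (r 2) 3 2 6 5,
      Node.meet (Pass.ofHeights (h 1) (h 2)) (r 1) (r 2) 4 5 7 8]
    ![0, 1, 2, 6, 7, 8]

/-- The same three strands after one of them has been moved over the meeting point of the two
others: every strand meets the two others in the opposite order. -/
def triangle' (h : Fin 3 → ℕ) (r : Fin 3 → Bool) : Fragment 6 :=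
  ofTable 9 3
    ![Node.meet (Pass.ofHeights (h 1) (h 2)) (r 1) (r 2) 1 2 4 5,
      Node.meet (Pass.ofHeights (h 0) (h 2)) (r 0) (r 2) 0 5 3 8,
      Node.meet (Pass.ofHeights (h 0) (h 1)) (r 0) (r 1) 3 4 6 7]
    ![0, 1, 2, 6, 7, 8]

/-- The local pictures of the oriented Reidemeister moves of singular links, for all choices of
orientations and crossings. The first three are the classical moves I, II, III. The move `sII`
slides a classical crossing of two strands through a double point of the same strands. The move
`sIII` moves a strand over or under a double point of two other strands, which are those of the
same height. -/
inductive SingularLocalMove : {n : ℕ} → Fragment n → Fragment n → Prop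
  | rI_right (k : Kind) (hk : k ≠ .double) : SingularLocalMove strand (kinkRight k)
  | rI_left (k : Kind) (hk : k ≠ .double) : SingularLocalMove strand (kinkLeft k)
  | rII (p : Pass) (hp : p ≠ .flat) (r s : Bool) :
      SingularLocalMove twoStrands (twist p p.swap r s)
  | rIII (h : Fin 3 → ℕ) (hh : Function.Injective h) (r : Fin 3 → Bool) :
      SingularLocalMove (triangle h r) (triangle' h r)
  | sII (p : Pass) (hp : p ≠ .flat) (r s : Bool) :
      SingularLocalMove (twist p .flat r s) (twist .flat p r s)
  | sIII (h : Fin 3 → ℕ) (hh : (Set.range h).ncard = 2) (r : Fin 3 → Bool) :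
      SingularLocalMove (triangle h r) (triangle' h r)

/-- The local pictures of the oriented Reidemeister moves of pseudolinks: those of singular links,
with precrossings instead of singular crossings, and the move pI, which removes a kink at a
precrossing. -/
inductive PseudoLocalMove : {n : ℕ} → Fragment n → Fragment n → Prop
  | ofSingular {n : ℕ} {T T' : Fragment n} (h : SingularLocalMove T T') : PseudoLocalMove T T'
  | pI_right : PseudoLocalMove strand (kinkRight .double)
  | pI_left : PseudoLocalMove strand (kinkLeft .double)

/-- Two diagrams are related by replacing the picture `T` in a disc by `T'`, without any change
outside of the disc (the piece `C`), for some `T` and `T'` related by `R`. Since both diagrams are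
closed and planar, the crossings of the local pictures of the moves lie in a disc as drawn. -/
def Diagram.Replace (R : {n : ℕ} → Fragment n → Fragment n → Prop) (D D' : Diagram) : Prop :=
  ∃ (n : ℕ) (T T' C : Fragment n), R T T' ∧
    Nonempty (D.toFragment.Iso (glue T C)) ∧ Nonempty (D'.toFragment.Iso (glue T' C))

/-- The diagrams are the same up to planar isotopy, or they differ by one singular Reidemeister
move. -/
def SingularMove (D D' : Diagram) : Prop :=
  Nonempty (D.toFragment.Iso D'.toFragment) ∨ Diagram.Replace SingularLocalMove D D'

/-- The diagrams are the same up to planar isotopy, or they differ by one pseudo Reidemeister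
move. -/
def PseudoMove (D D' : Diagram) : Prop :=
  Nonempty (D.toFragment.Iso D'.toFragment) ∨ Diagram.Replace PseudoLocalMove D D'

/-- Oriented singular links: diagrams up to the equivalence relation generated by the singular
Reidemeister moves. -/
def OrientedSingularLink : Type 1 :=
  Quot SingularMove

/-- Oriented pseudolinks: diagrams up to the equivalence relation generated by the pseudo
Reidemeister moves. -/
def OrientedPseudolink : Type 1 :=
  Quot PseudoMove

/-- The singular link of a diagram. -/
def Diagram.singularLink (D : Diagram) : OrientedSingularLink :=
  Quot.mk _ D

/-- The pseudolink of a diagram. -/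
def Diagram.pseudolink (D : Diagram) : OrientedPseudolink :=
  Quot.mk _ D

end SingularLink

namespace Psyquandle

/-! ### Algebra of finite psyquandles. -/

open Biquandle

/-- For a finite switch-like map, the diagonal elements correspond to the diagonal elements. -/
lemma diag_unique {Y : Type*} [Finite Y] {A B : Y → Y → Y} (hd : ∀ x, A x x = B x x)
    (hs : Function.Injective (fun p : Y × Y => (B p.2 p.1, A p.1 p.2))) :
    Function.Bijective (fun x => A x x) ∧ ∀ x y, A x y = B y x → x = y := by
  have hinj : Function.Injective (fun x => A x x) := fun x y h => by
    have h' : A x x = A y y := h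
    have : ((x, x) : Y × Y) = (y, y) := hs (by simp [← hd, h'])
    exact (Prod.ext_iff.1 this).1
  have hbij := Finite.injective_iff_bijective.1 hinj
  refine ⟨hbij, fun x y h => ?_⟩
  -- Since `A x y = B y x`, the image of `(x, y)` is diagonal, hence it is also the image of some
  -- `(z, z)`.
  obtain ⟨z, hz⟩ := hbij.surjective (A x y)
  have hz' : A z z = A x y := hz
  have : ((x, y) : Y × Y) = (z, z) := hs (by simp [← hd, ← h, hz'])
  have := Prod.ext_iff.1 this
  exact this.1.trans this.2.symm

variable {X : Type*} [Psyquandle X]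

lemma otri_left_injective (y : X) : Function.Injective (fun x => otri x y) :=
  (otri_bijective y).injective

lemma odot_left_injective (y : X) : Function.Injective (fun x => odot x y) :=
  (odot_bijective y).injective

lemma udot_left_injective (y : X) : Function.Injective (fun x => udot x y) :=
  (udot_bijective y).injective

lemma switch_injective {x y x' y' : X} (h₁ : otri y x = otri y' x')
    (h₂ : utri x y = utri x' y') : x = x' ∧ y = y' := by
  have : ((x, y) : X × X) = (x', y') := switch_bijective.injective (Prod.ext h₁ h₂)
  exact Prod.ext_iff.1 this

/-- The psyquandle with the two biquandle operations exchanged. -/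
abbrev dual (X : Type*) [Psyquandle X] : Psyquandle X where
  utri := otri
  otri := utri
  diag x := (diag x).symm
  otri_bijective := utri_bijective
  utri_bijective := otri_bijective
  switch_bijective :=
    (Equiv.prodComm X X).bijective.comp
      ((switch_bijective (X := X)).comp (Equiv.prodComm X X).bijective)
  exchange_utri_utri := exchange_otri_otri
  exchange_utri_otri x y z := (exchange_utri_otri x z y).symm
  exchange_otri_otri := exchange_utri_utri
  udot := udot
  odot := odot
  odot_bijective := odot_bijective
  udot_bijective := udot_bijective
  bswitch_bijective := bswitch_bijective
  existsUnique_pair x y := by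
    obtain ⟨⟨w, z⟩, ⟨h₁, h₂, h₃, h₄⟩, hu⟩ := existsUnique_pair y x
    refine ⟨(z, w), ⟨h₂, h₁, h₄, h₃⟩, fun p hp => ?_⟩
    have := hu (p.2, p.1) ⟨hp.2.1, hp.1, hp.2.2.2, hp.2.2.1⟩
    exact Prod.ext (Prod.ext_iff.1 this).2 (Prod.ext_iff.1 this).1
  mixed_otri := mixed_utri
  mixed_utri := mixed_otri
  mixed_otri_odot := mixed_utri_odot
  mixed_utri_udot := mixed_otri_udot
  mixed_otri_udot := mixed_utri_udot
  mixed_utri_odot := mixed_otri_odot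

lemma exists_pair (x y : X) : ∃ w z : X, utri x y = odot z y ∧ otri y x = odot w x ∧
    utri w z = udot y z ∧ otri z w = udot x w := by
  obtain ⟨⟨w, z⟩, h, -⟩ := existsUnique_pair x y
  exact ⟨w, z, h⟩

/-- The last two equations recover `x` and `y` from `(w, z)`, because right multiplication for
`udot` is injective. So `(x, y) ↦ (w, z)` is injective, and surjective by finiteness. -/
lemma exists_pair_symm [Finite X] (w z : X) : ∃ x y : X, utri x y = odot z y ∧
    otri y x = odot w x ∧ utri w z = udot y z ∧ otri z w = udot x w := by
  choose F hF using fun p : X × X => exists_pair p.1 p.2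
  choose G hG using hF
  have hinj : Function.Injective (fun p : X × X => (F p, G p)) := by
    intro p q h
    obtain ⟨hf, hg⟩ := Prod.ext_iff.1 h
    dsimp only at hf hg
    obtain ⟨-, -, p₃, p₄⟩ := hG p
    obtain ⟨-, -, q₃, q₄⟩ := hG q
    rw [← hf, ← hg] at q₃ q₄
    exact Prod.ext (udot_left_injective _ (p₄.symm.trans q₄))
      (udot_left_injective _ (p₃.symm.trans q₃))
  obtain ⟨⟨x, y⟩, h⟩ := (Finite.injective_iff_surjective.1 hinj) (w, z)
  obtain ⟨hf, hg⟩ := Prod.ext_iff.1 h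
  dsimp only at hf hg
  have := hG (x, y)
  rw [hf, hg] at this
  exact ⟨x, y, this⟩

/-- The algebraic form of sliding a classical crossing through a double point of two strands
with opposite directions. -/
lemma exists_antiparallel [Finite X] (x y : X) : ∃ u v : X, utri y x = udot u v ∧
    otri x y = odot v u ∧ udot x y = utri v u ∧ odot y x = otri u v := by
  -- With this pair, `mixed_utri_odot` at a repeated argument forces `z = utri y x`.
  obtain ⟨w, z, h₁, h₂, h₃, h₄⟩ := exists_pair (odot y x) (utri x x)
  have hz : z = utri y x := by
    refine odot_left_injective (utri x x) (h₁.symm.trans ?_)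
    have := mixed_utri_odot y x x
    rw [← diag x] at this
    exact this.symm
  subst hz
  -- By finiteness `w` is a diagonal value. Written as `utri v v = otri v v`, it fits the mixed laws
  -- again.
  obtain ⟨v, hv⟩ := (diag_unique (A := utri) (B := otri) (diag (X := X))
    switch_bijective.injective).1.surjective w
  obtain ⟨u, hu⟩ := (otri_bijective v).surjective (odot y x)
  have hv : utri v v = w := hv
  have hu : otri u v = odot y x := hu
  have ha : utri y x = udot u v := by
    refine otri_left_injective w (h₄.trans ?_)
    have := mixed_otri_udot u v v
    rw [← diag v, hv, hu] at this
    exact this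
  have hb : utri (utri v u) (odot v u) = utri (udot x y) (otri x y) := by
    rw [mixed_utri v u v, hv, ← ha, h₃, mixed_utri_udot x x y]
  have hd : otri (odot v u) (utri v u) = otri (otri x y) (udot x y) := by
    rw [← mixed_otri_odot v v u, ← diag v, hv, hu, ← h₂, diag, mixed_otri x x y]
  -- The switch map takes the same value at `(utri v u, odot v u)` and at `(udot x y, otri x y)`.
  obtain ⟨h, h'⟩ := switch_injective hd hb
  exact ⟨u, v, ha, h'.symm, h.symm, hu.symm⟩

lemma exists_antiparallel' [Finite X] (x y : X) : ∃ u v : X, otri y x = udot u v ∧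
    utri x y = odot v u ∧ udot x y = otri v u ∧ odot y x = utri u v :=
  @exists_antiparallel X (dual X) _ x y

end Psyquandle

/-! ### One crossing, read from any of its ends. -/

namespace SingularLink

open Biquandle Psyquandle

lemma Pass.swap_ofHeights (h h' : ℕ) : (Pass.ofHeights h h').swap = Pass.ofHeights h' h := by
  unfold Pass.ofHeights
  rcases lt_trichotomy h h' with H | H | H
  · simp [H, H.ne, H.ne', H.not_gt, Pass.swap]
  · simp [H, Pass.swap]
  · simp [H, H.ne, H.ne', H.not_gt, Pass.swap]

lemma Node.map_map {A B C : Type*} (f : A → B) (g : B → C) (c : Node A) :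
    (c.map f).map g = c.map (g ∘ f) := rfl

lemma Node.map_meet {A B : Type*} (f : A → B) (p : Pass) (r s : Bool) (a b a' b' : A) :
    (Node.meet p r s a b a' b').map f = Node.meet p r s (f a) (f b) (f a') (f b') := by
  cases r <;> cases s <;> rfl

/-- A quarter turn of the reading: the second strand comes first, and the first strand, now read
from its other end, comes second with its direction flag negated. -/
lemma Node.meet_rotate {A : Type*} (p : Pass) (r s : Bool) (a b a' b' : A) :
    Node.meet p.swap s (!r) b a' b' a = Node.meet p r s a b a' b' := by
  cases p <;> cases r <;> cases s <;> rfl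

/-- The known ends are in turn the bottom, right, top and left ones of an upward crossing. The first
three cases use the bijectivity of `A · a`, of the switch map and of `B · b`; in the last the rule
is already a function. -/
lemma existsUnique_ends {X : Type*} {A B : X → X → X} (hA : ∀ y, Function.Bijective (fun x => A x y))
    (hB : ∀ y, Function.Bijective (fun x => B x y))
    (hs : Function.Bijective (fun p : X × X => (B p.2 p.1, A p.1 p.2))) (a b : X) :
    (∃! q : X × X, b = A q.2 a ∧ q.1 = B a q.2) ∧ (∃! q : X × X, a = A q.1 q.2 ∧ b = B q.2 q.1) ∧
    (∃! q : X × X, q.2 = A b q.1 ∧ a = B q.1 b) ∧ (∃! q : X × X, q.1 = A a b ∧ q.2 = B b a) := by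
  refine ⟨?_, ?_, ?_, ?_⟩
  · obtain ⟨x, hx, hu⟩ := (hA a).existsUnique b
    refine ⟨(B a x, x), ⟨hx.symm, rfl⟩, fun q hq => ?_⟩
    obtain rfl := hu q.2 hq.1.symm
    exact Prod.ext hq.2 rfl
  · obtain ⟨q, hq, hu⟩ := hs.existsUnique (b, a)
    obtain ⟨h₁, h₂⟩ := Prod.ext_iff.1 hq
    exact ⟨q, ⟨h₂.symm, h₁.symm⟩, fun q' hq' => hu q' (Prod.ext hq'.2.symm hq'.1.symm)⟩
  · obtain ⟨x, hx, hu⟩ := (hB b).existsUnique a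
    refine ⟨(x, A b x), ⟨rfl, hx.symm⟩, fun q hq => ?_⟩
    obtain rfl := hu q.1 hq.2.symm
    exact Prod.ext rfl hq.1
  · exact ⟨(A a b, B b a), ⟨rfl, rfl⟩, fun q hq => Prod.ext hq.1 hq.2⟩

section Meet

variable {X : Type*} [Psyquandle X]

/-- The colours at the ends `a, b, a', b'` of a crossing of two strands obey the colouring rule. -/
def Meets (p : Pass) (r s : Bool) (a b a' b' : X) : Prop :=
  (Node.meet p r s a b a' b').IsColored

lemma meets_rotate (p : Pass) (r s : Bool) (a b a' b' : X) :
    Meets p.swap s (!r) b a' b' a ↔ Meets p r s a b a' b' := by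
  unfold Meets
  rw [Node.meet_rotate]

/-- Exchanging the bottom and the top of a classical crossing turns the positive rule into the
negative one. This makes the two crossings of move II inverse to each other. -/
lemma meets_mirror {p : Pass} (hp : p ≠ .flat) (r s : Bool) (a b a' b' : X) :
    Meets p.swap s r b' a' b a ↔ Meets p r s a b a' b' := by
  cases p <;> cases r <;> cases s <;>
    simp [Meets, Node.meet, Node.IsColored, Pass.swap, Pass.kind, and_comm] at hp ⊢

/-- Reversing the second strand inverts the effect of passing it on the colours of the first. -/
lemma meets_flip {p : Pass} (hp : p ≠ .flat) (r s : Bool) (a b a' b' : X) :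
    Meets p r (!s) a' b a b' ↔ Meets p r s a b a' b' := by
  cases p <;> cases r <;> cases s <;>
    simp [Meets, Node.meet, Node.IsColored, Pass.swap, Pass.kind, and_comm] at hp ⊢

lemma existsUnique_meets (p : Pass) (r s : Bool) (a b : X) :
    ∃! q : X × X, Meets p r s a b q.1 q.2 := by
  have hp := existsUnique_ends (X := X) utri_bijective otri_bijective switch_bijective a b
  have hn := existsUnique_ends (X := X) otri_bijective utri_bijective
    ((Equiv.prodComm X X).bijective.comp
      ((switch_bijective (X := X)).comp (Equiv.prodComm X X).bijective)) a b
  have hd := existsUnique_ends (X := X) udot_bijective odot_bijective bswitch_bijective a b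
  cases p <;> cases r <;> cases s
  all_goals
    simp only [Meets, Node.meet, Node.IsColored, Pass.swap, Pass.kind]
    first
      | exact hp.1 | exact hp.2.1 | exact hp.2.2.1 | exact hp.2.2.2
      | exact hn.1 | exact hn.2.1 | exact hn.2.2.1 | exact hn.2.2.2
      | exact hd.1 | exact hd.2.1 | exact hd.2.2.1 | exact hd.2.2.2
      | simpa only [and_comm] using hp.1 | simpa only [and_comm] using hp.2.1
      | simpa only [and_comm] using hp.2.2.1 | simpa only [and_comm] using hp.2.2.2
      | simpa only [and_comm] using hn.1 | simpa only [and_comm] using hn.2.1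
      | simpa only [and_comm] using hn.2.2.1 | simpa only [and_comm] using hn.2.2.2

lemma exists_meets (p : Pass) (r s : Bool) (a b : X) : ∃ a' b', Meets p r s a b a' b' := by
  obtain ⟨q, hq, -⟩ := existsUnique_meets p r s a b
  exact ⟨_, _, hq⟩

lemma Meets.unique {p : Pass} {r s : Bool} {a b a₁ b₁ a₂ b₂ : X} (h₁ : Meets p r s a b a₁ b₁)
    (h₂ : Meets p r s a b a₂ b₂) : a₁ = a₂ ∧ b₁ = b₂ :=
  Prod.ext_iff.1 ((existsUnique_meets p r s a b).unique (y₁ := (a₁, b₁)) (y₂ := (a₂, b₂)) h₁ h₂)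

lemma meets_rotate_twice (p : Pass) (r s : Bool) (a b a' b' : X) :
    Meets p (!r) (!s) a' b' a b ↔ Meets p r s a b a' b' := by
  rw [← meets_rotate p r s, ← meets_rotate p.swap]
  cases p <;> rfl

lemma exists_meets_symm (p : Pass) (r s : Bool) (a' b' : X) : ∃ a b, Meets p r s a b a' b' := by
  obtain ⟨a, b, h⟩ := exists_meets p (!r) (!s) a' b'
  exact ⟨a, b, (meets_rotate_twice ..).1 h⟩

lemma Meets.unique_symm {p : Pass} {r s : Bool} {a' b' a₁ b₁ a₂ b₂ : X}
    (h₁ : Meets p r s a₁ b₁ a' b') (h₂ : Meets p r s a₂ b₂ a' b') : a₁ = a₂ ∧ b₁ = b₂ :=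
  ((meets_rotate_twice ..).2 h₁).unique ((meets_rotate_twice ..).2 h₂)

end Meet

/-! ### Extendable boundary colours: triangles, twists and kinks. -/

section Moves

variable {X : Type*} [Psyquandle X]

/-- The colours of the boundary points of the first picture of a triangle move extend to a
colouring. -/
def TriangleExtends (h : Fin 3 → ℕ) (r : Fin 3 → Bool) (x₀ x₁ x₂ x₆ x₇ x₈ : X) : Prop :=
  ∃ x₃ x₄ x₅, Meets (Pass.ofHeights (h 0) (h 1)) (r 0) (r 1) x₀ x₁ x₃ x₄ ∧
    Meets (Pass.ofHeights (h 0) (h 2)) (r 0) (r 2) x₃ x₂ x₆ x₅ ∧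
    Meets (Pass.ofHeights (h 1) (h 2)) (r 1) (r 2) x₄ x₅ x₇ x₈

/-- The colours of the boundary points of the second picture of a triangle move extend to a
colouring. -/
def TriangleExtends' (h : Fin 3 → ℕ) (r : Fin 3 → Bool) (x₀ x₁ x₂ x₆ x₇ x₈ : X) : Prop :=
  ∃ x₃ x₄ x₅, Meets (Pass.ofHeights (h 1) (h 2)) (r 1) (r 2) x₁ x₂ x₄ x₅ ∧
    Meets (Pass.ofHeights (h 0) (h 2)) (r 0) (r 2) x₀ x₅ x₃ x₈ ∧
    Meets (Pass.ofHeights (h 0) (h 1)) (r 0) (r 1) x₃ x₄ x₆ x₇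

variable (X) in
/-- The two pictures of a triangle move have the same colourings. -/
def TriangleInvariant (h : Fin 3 → ℕ) (r : Fin 3 → Bool) : Prop :=
  ∀ x₀ x₁ x₂ x₆ x₇ x₈ : X,
    TriangleExtends h r x₀ x₁ x₂ x₆ x₇ x₈ ↔ TriangleExtends' h r x₀ x₁ x₂ x₆ x₇ x₈

/-- In both pictures `x₀, x₁, x₂` can be prescribed freely and determine the rest, and a function
whose graph contains the graph of another equals it. -/
lemma TriangleInvariant.of_imp {h : Fin 3 → ℕ} {r : Fin 3 → Bool}
    (H : ∀ x₀ x₁ x₂ x₆ x₇ x₈ : X,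
      TriangleExtends h r x₀ x₁ x₂ x₆ x₇ x₈ → TriangleExtends' h r x₀ x₁ x₂ x₆ x₇ x₈) :
    TriangleInvariant X h r := by
  intro x₀ x₁ x₂ x₆ x₇ x₈
  refine ⟨H _ _ _ _ _ _, ?_⟩
  rintro ⟨y₃, y₄, y₅, k₁, k₂, k₃⟩
  obtain ⟨x₃, x₄, h₁⟩ := exists_meets (Pass.ofHeights (h 0) (h 1)) (r 0) (r 1) x₀ x₁
  obtain ⟨z₆, x₅, h₂⟩ := exists_meets (Pass.ofHeights (h 0) (h 2)) (r 0) (r 2) x₃ x₂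
  obtain ⟨z₇, z₈, h₃⟩ := exists_meets (Pass.ofHeights (h 1) (h 2)) (r 1) (r 2) x₄ x₅
  have ht : TriangleExtends h r x₀ x₁ x₂ z₆ z₇ z₈ := ⟨x₃, x₄, x₅, h₁, h₂, h₃⟩
  obtain ⟨w₃, w₄, w₅, l₁, l₂, l₃⟩ := H _ _ _ _ _ _ ht
  obtain ⟨rfl, rfl⟩ := k₁.unique l₁
  obtain ⟨rfl, rfl⟩ := k₂.unique l₂
  obtain ⟨rfl, rfl⟩ := k₃.unique l₃
  exact ht

/-- A sixth of a turn of the disc makes point `1` the first one. Strand `0` becomes the last and is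
read backwards, and the two pictures change places. -/
lemma TriangleInvariant.rotate {h : Fin 3 → ℕ} {r : Fin 3 → Bool}
    (H : TriangleInvariant X h r) :
    TriangleInvariant X ![h 1, h 2, h 0] ![r 1, r 2, !(r 0)] := by
  intro x₁ x₂ x₆ x₇ x₈ x₀
  have h₁ : TriangleExtends ![h 1, h 2, h 0] ![r 1, r 2, !(r 0)] x₁ x₂ x₆ x₇ x₈ x₀ ↔
      TriangleExtends' h r x₀ x₁ x₂ x₆ x₇ x₈ := by
    constructor
    · rintro ⟨x₄, x₅, x₃, k₁, k₂, k₃⟩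
      refine ⟨x₃, x₄, x₅, k₁, ?_, ?_⟩
      · rw [← meets_rotate, Pass.swap_ofHeights]; exact k₃
      · rw [← meets_rotate, Pass.swap_ofHeights]; exact k₂
    · rintro ⟨x₃, x₄, x₅, k₁, k₂, k₃⟩
      refine ⟨x₄, x₅, x₃, k₁, ?_, ?_⟩
      · rw [← meets_rotate, Pass.swap_ofHeights] at k₃; exact k₃
      · rw [← meets_rotate, Pass.swap_ofHeights] at k₂; exact k₂
  have h₂ : TriangleExtends' ![h 1, h 2, h 0] ![r 1, r 2, !(r 0)] x₁ x₂ x₆ x₇ x₈ x₀ ↔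
      TriangleExtends h r x₀ x₁ x₂ x₆ x₇ x₈ := by
    constructor
    · rintro ⟨x₄, x₅, x₃, k₁, k₂, k₃⟩
      refine ⟨x₃, x₄, x₅, ?_, ?_, k₃⟩
      · rw [← meets_rotate, Pass.swap_ofHeights]; exact k₂
      · rw [← meets_rotate, Pass.swap_ofHeights]; exact k₁
    · rintro ⟨x₃, x₄, x₅, k₁, k₂, k₃⟩
      refine ⟨x₄, x₅, x₃, ?_, ?_, k₃⟩
      · rw [← meets_rotate, Pass.swap_ofHeights] at k₂; exact k₂
      · rw [← meets_rotate, Pass.swap_ofHeights] at k₁; exact k₁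
  rw [h₁, h₂, H]

lemma Pass.ofHeights_ne_flat {a b : ℕ} (h : a ≠ b) : Pass.ofHeights a b ≠ .flat := by
  unfold Pass.ofHeights
  split_ifs <;> simp_all

/-- Reversing the third strand, which meets the others in classical crossings. -/
lemma TriangleInvariant.flip {h : Fin 3 → ℕ} {r : Fin 3 → Bool}
    (H : TriangleInvariant X h r) (h₀ : h 0 ≠ h 2) (h₁ : h 1 ≠ h 2) :
    TriangleInvariant X h ![r 0, r 1, !(r 2)] := by
  have p₀ := Pass.ofHeights_ne_flat h₀
  have p₁ := Pass.ofHeights_ne_flat h₁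
  refine TriangleInvariant.of_imp ?_
  rintro x₀ x₁ x₂ x₆ x₇ x₈ ⟨x₃, x₄, x₅, k₁, k₂, k₃⟩
  -- If `S` and `S'` are the passages across the third strand and `M` the meeting of the others, a
  -- relation `S' M = M S` is equivalent to `M S⁻¹ = S'⁻¹ M`; `a, b` are the colours between the two
  -- factors.
  obtain ⟨a, b, l⟩ := exists_meets_symm (Pass.ofHeights (h 0) (h 1)) (r 0) (r 1) x₆ x₇
  have k₂' := (meets_flip p₀ _ (!(r 2)) _ _ _ _).2 k₂
  have k₃' := (meets_flip p₁ _ (!(r 2)) _ _ _ _).2 k₃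
  rw [Bool.not_not] at k₂' k₃'
  obtain ⟨y₃, y₄, y₅, m₁, m₂, m₃⟩ := (H a b x₂ x₃ x₄ x₈).1 ⟨x₆, x₇, x₅, l, k₂', k₃'⟩
  obtain ⟨rfl, rfl⟩ := m₃.unique_symm k₁
  exact ⟨a, b, y₅, (meets_flip p₁ _ _ _ _ _ _).2 m₁, (meets_flip p₀ _ _ _ _ _ _).2 m₂, l⟩

lemma triangleInvariant_upward (h : Fin 3 → ℕ) (hh : ¬ (h 0 = h 1 ∧ h 1 = h 2)) :
    TriangleInvariant X h ![false, false, false] := by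
  refine TriangleInvariant.of_imp ?_
  rintro x₀ x₁ x₂ x₆ x₇ x₈ ⟨x₃, x₄, x₅, k₁, k₂, k₃⟩
  -- The rule expresses right colours by left colours, so all colours become terms in `x₀, x₄, x₈`.
  -- What remains is three equations, each an exchange law or a mixed law.
  obtain ⟨y₃, y₅, m₁⟩ : ∃ y₃ y₅,
      Meets (Pass.ofHeights (h 0) (h 2)) false false x₀ y₅ y₃ x₈ := by
    obtain ⟨y₅, y₃, m⟩ :=
      exists_meets (Pass.ofHeights (h 2) (h 0)) true false x₈ x₀
    refine ⟨y₃, y₅, ?_⟩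
    rw [← meets_rotate, ← meets_rotate, ← meets_rotate]
    simpa [Pass.swap_ofHeights] using m
  obtain ⟨y₆, y₄, m₂⟩ : ∃ y₆ y₄,
      Meets (Pass.ofHeights (h 0) (h 1)) false false y₃ y₄ y₆ x₇ := by
    obtain ⟨y₄, y₆, m⟩ :=
      exists_meets (Pass.ofHeights (h 1) (h 0)) true false x₇ y₃
    refine ⟨y₆, y₄, ?_⟩
    rw [← meets_rotate, ← meets_rotate, ← meets_rotate]
    simpa [Pass.swap_ofHeights] using m
  suffices Meets (Pass.ofHeights (h 1) (h 2)) false false x₁ x₂ y₄ y₅ ∧ x₆ = y₆ by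
    obtain ⟨g, rfl⟩ := this
    exact ⟨y₃, y₄, y₅, g, m₁, m₂⟩
  revert k₁ k₂ k₃ m₁ m₂
  simp only [Matrix.cons_val]
  have hlt {a b : ℕ} (H : a < b) : Pass.ofHeights a b = .below := by
    simp [Pass.ofHeights, H.ne, H.not_gt]
  have heq {a b : ℕ} (H : a = b) : Pass.ofHeights a b = .flat := by
    simp [Pass.ofHeights, H]
  have hgt {a b : ℕ} (H : b < a) : Pass.ofHeights a b = .above := by
    simp [Pass.ofHeights, H.ne', H]
  rcases lt_trichotomy (h 0) (h 1) with H₁ | H₁ | H₁ <;>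
  rcases lt_trichotomy (h 0) (h 2) with H₂ | H₂ | H₂ <;>
  rcases lt_trichotomy (h 1) (h 2) with H₃ | H₃ | H₃ <;>
  first
  | omega
  | first | rw [hlt H₁] | rw [heq H₁] | rw [hgt H₁]
    first | rw [hlt H₂] | rw [heq H₂] | rw [hgt H₂]
    first | rw [hlt H₃] | rw [heq H₃] | rw [hgt H₃]
    simp only [Meets, Node.meet, Pass.kind, Node.IsColored]
    rintro ⟨rfl, rfl⟩ ⟨rfl, rfl⟩ ⟨rfl, rfl⟩ ⟨rfl, rfl⟩ ⟨rfl, rfl⟩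
    refine ⟨⟨?_, ?_⟩, ?_⟩ <;>
    simp only [exchange_utri_utri, exchange_otri_otri, exchange_utri_otri, mixed_otri,
      mixed_utri, mixed_otri_odot, mixed_utri_udot, mixed_otri_udot, mixed_utri_odot]

/-- The two pictures of the moves III and sIII have the same colourings. -/
theorem triangleInvariant (h : Fin 3 → ℕ) (hh : ¬ (h 0 = h 1 ∧ h 1 = h 2)) (r : Fin 3 → Bool) :
    TriangleInvariant X h r := by
  -- Successive turns starting from three upward strands reach six direction patterns. In the other
  -- two the middle triangle is cyclically oriented.
  have R (h : Fin 3 → ℕ) {a b c : Bool} (H : TriangleInvariant X ![h 2, h 0, h 1] ![c, a, b]) :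
      TriangleInvariant X h ![a, b, !c] := by
    have e : h = ![h 0, h 1, h 2] := by ext i; fin_cases i <;> rfl
    rw [e]
    exact H.rotate
  have H₁ (h : Fin 3 → ℕ) (hh : ¬ (h 0 = h 1 ∧ h 1 = h 2)) :
      TriangleInvariant X h ![false, false, true] :=
    R h (triangleInvariant_upward _ (by simp; omega))
  have H₂ (h : Fin 3 → ℕ) (hh : ¬ (h 0 = h 1 ∧ h 1 = h 2)) :
      TriangleInvariant X h ![false, true, true] := R h (H₁ _ (by simp; omega))
  have H₃ (h : Fin 3 → ℕ) (hh : ¬ (h 0 = h 1 ∧ h 1 = h 2)) :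
      TriangleInvariant X h ![true, true, true] := R h (H₂ _ (by simp; omega))
  have H₄ (h : Fin 3 → ℕ) (hh : ¬ (h 0 = h 1 ∧ h 1 = h 2)) :
      TriangleInvariant X h ![true, true, false] := R h (H₃ _ (by simp; omega))
  have H₅ (h : Fin 3 → ℕ) (hh : ¬ (h 0 = h 1 ∧ h 1 = h 2)) :
      TriangleInvariant X h ![true, false, false] := R h (H₄ _ (by simp; omega))
  have A (h : Fin 3 → ℕ) (h₀ : h 0 ≠ h 2) (h₁ : h 1 ≠ h 2) :
      TriangleInvariant X h ![false, true, false] ∧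
        TriangleInvariant X h ![true, false, true] :=
    ⟨(H₂ h (by omega)).flip h₀ h₁, (H₅ h (by omega)).flip h₀ h₁⟩
  have H₆ : TriangleInvariant X h ![false, true, false] ∧
      TriangleInvariant X h ![true, false, true] := by
    -- Some strand differs in height from both others; turns bring it to the third place, where it
    -- can be reversed.
    rcases (by omega : (h 0 ≠ h 2 ∧ h 1 ≠ h 2) ∨ (h 2 ≠ h 1 ∧ h 0 ≠ h 1) ∨
      (h 1 ≠ h 0 ∧ h 2 ≠ h 0)) with hi | hi | hi
    · exact A h hi.1 hi.2
    · have := A ![h 2, h 0, h 1] hi.1 hi.2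
      exact ⟨R h this.2, R h this.1⟩
    · have := A ![h 1, h 2, h 0] hi.1 hi.2
      exact ⟨R h (R _ this.1), R h (R _ this.2)⟩
  have e : r = ![r 0, r 1, r 2] := by ext i; fin_cases i <;> rfl
  rw [e]
  cases r 0 <;> cases r 1 <;> cases r 2
  exacts [triangleInvariant_upward h hh, H₁ h hh, H₆.1, H₂ h hh, H₅ h hh, H₆.2, H₄ h hh, H₃ h hh]

/-- The colours of the boundary points of two strands that meet twice extend to a colouring. -/
def TwistExtends (p q : Pass) (r s : Bool) (x₀ x₁ x₄ x₅ : X) : Prop :=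
  ∃ x₂ x₃, Meets p r s x₀ x₁ x₂ x₃ ∧ Meets q s r x₃ x₂ x₅ x₄

lemma twistExtends_swap {p : Pass} (hp : p ≠ .flat) (r s : Bool) (x₀ x₁ x₄ x₅ : X) :
    TwistExtends p p.swap r s x₀ x₁ x₄ x₅ ↔ x₀ = x₄ ∧ x₁ = x₅ := by
  constructor
  · rintro ⟨x₂, x₃, h₁, h₂⟩
    have := ((meets_mirror hp _ _ _ _ _ _).2 h₁).unique h₂
    exact this.symm
  · rintro ⟨rfl, rfl⟩
    obtain ⟨x₂, x₃, h⟩ := exists_meets p r s x₀ x₁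
    exact ⟨x₂, x₃, h, (meets_mirror hp _ _ _ _ _ _).2 h⟩

lemma TwistExtends.slide [Finite X] {p : Pass} (hp : p ≠ .flat) {r s : Bool} {x₀ x₁ x₄ x₅ : X}
    (H : TwistExtends p .flat r s x₀ x₁ x₄ x₅) : TwistExtends .flat p r s x₀ x₁ x₄ x₅ := by
  obtain ⟨x₂, x₃, h₁, h₂⟩ := H
  unfold TwistExtends
  -- Equal directions lead to the pair axiom, opposite ones to the antiparallel lemmas. Injectivity
  -- matches the colours produced with the given ones.
  cases p <;> cases r <;> cases s <;>
    simp only [Meets, Node.meet, Pass.kind, Pass.swap, Node.IsColored, ne_eq, reduceCtorEq,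
      not_true_eq_false, not_false_eq_true] at hp h₁ h₂ ⊢
  · obtain ⟨x, y, e₁, e₂, e₃, e₄⟩ := exists_pair_symm x₃ x₀
    obtain rfl : x = x₄ := udot_left_injective x₃ (e₄.symm.trans (h₁.2.symm.trans h₂.1))
    exact ⟨odot x₀ y, y, ⟨h₁.1.trans e₃, rfl⟩, e₁.symm, h₂.2.trans e₂.symm⟩
  · obtain ⟨u, v, e₁, e₂, e₃, e₄⟩ := exists_antiparallel' x₃ x₂
    exact ⟨u, v, ⟨h₁.2.trans e₁, h₁.1.trans e₂⟩, h₂.2.trans e₄, h₂.1.trans e₃⟩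
  · obtain ⟨u, v, e₁, e₂, e₃, e₄⟩ := exists_antiparallel x₅ x₄
    obtain ⟨rfl, rfl⟩ : v = x₁ ∧ u = x₀ :=
      switch_injective (e₄.symm.trans (h₂.2.symm.trans h₁.2))
        (e₃.symm.trans (h₂.1.symm.trans h₁.1))
    exact ⟨_, _, ⟨rfl, rfl⟩, e₁.symm, e₂.symm⟩
  · obtain ⟨w, z, e₁, e₂, e₃, e₄⟩ := exists_pair x₁ x₂
    obtain rfl : z = x₅ := odot_left_injective x₂ (e₁.symm.trans (h₁.1.symm.trans h₂.2))
    exact ⟨w, _, ⟨rfl, h₁.2.trans e₂⟩, h₂.1.trans e₃.symm, e₄.symm⟩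
  · obtain ⟨x, y, e₁, e₂, e₃, e₄⟩ := exists_pair_symm x₀ x₃
    obtain rfl : y = x₄ := udot_left_injective x₃ (e₃.symm.trans (h₁.1.symm.trans h₂.1))
    exact ⟨_, x, ⟨h₁.2.trans e₄, rfl⟩, h₂.2.trans e₁.symm, e₂.symm⟩
  · obtain ⟨u, v, e₁, e₂, e₃, e₄⟩ := exists_antiparallel x₃ x₂
    exact ⟨u, v, ⟨h₁.1.trans e₁, h₁.2.trans e₂⟩, h₂.1.trans e₃, h₂.2.trans e₄⟩
  · obtain ⟨u, v, e₁, e₂, e₃, e₄⟩ := exists_antiparallel' x₅ x₄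
    obtain ⟨rfl, rfl⟩ : u = x₀ ∧ v = x₁ :=
      switch_injective (e₃.symm.trans (h₂.1.symm.trans h₁.2))
        (e₄.symm.trans (h₂.2.symm.trans h₁.1))
    exact ⟨_, _, ⟨rfl, rfl⟩, e₂.symm, e₁.symm⟩
  · obtain ⟨w, z, e₁, e₂, e₃, e₄⟩ := exists_pair x₂ x₁
    obtain rfl : w = x₅ := odot_left_injective x₂ (e₂.symm.trans (h₁.2.symm.trans h₂.2))
    exact ⟨z, _, ⟨rfl, h₁.1.trans e₁⟩, e₃.symm, h₂.1.trans e₄.symm⟩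

/-- Both sides are graphs of functions of `(x₀, x₁)`, so the converse follows from
`TwistExtends.slide`. -/
lemma twistExtends_slide [Finite X] {p : Pass} (hp : p ≠ .flat) (r s : Bool) (x₀ x₁ x₄ x₅ : X) :
    TwistExtends p .flat r s x₀ x₁ x₄ x₅ ↔ TwistExtends .flat p r s x₀ x₁ x₄ x₅ := by
  refine ⟨TwistExtends.slide hp, ?_⟩
  rintro ⟨y₂, y₃, k₁, k₂⟩
  obtain ⟨x₂, x₃, h₁⟩ := exists_meets p r s x₀ x₁
  obtain ⟨z₅, z₄, h₂⟩ := exists_meets .flat s r x₃ x₂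
  have ht : TwistExtends p .flat r s x₀ x₁ z₄ z₅ := ⟨x₂, x₃, h₁, h₂⟩
  obtain ⟨w₂, w₃, l₁, l₂⟩ := ht.slide hp
  obtain ⟨rfl, rfl⟩ := k₁.unique l₁
  obtain ⟨rfl, rfl⟩ := k₂.unique l₂
  exact ht

/-- The colours of the ends of a strand with a kink on the right extend to a colouring. -/
lemma kinkRight_extends [Finite X] {k : Kind} (hk : k = .double → IsPIAdequate X) (x₀ x₂ : X) :
    (∃ x₁, (⟨k, x₀, x₁, x₂, x₁⟩ : Node X).IsColored) ↔ x₀ = x₂ := by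
  -- Eliminating the loop colour leaves an equation `A x y = B y x`, which forces `x = y`.
  have hb := (diag_unique (A := utri) (B := otri) (diag (X := X)) switch_bijective.injective).2
  cases k <;> simp only [Node.IsColored]
  · exact ⟨fun ⟨_, h₁, h₂⟩ => (hb _ _ (h₁.symm.trans h₂)).symm,
      fun h => ⟨_, rfl, h ▸ diag _⟩⟩
  · exact ⟨fun ⟨_, h₁, h₂⟩ => hb _ _ (h₁.symm.trans h₂), fun h => ⟨_, rfl, h ▸ diag _⟩⟩
  · have hd := (diag_unique (A := udot) (B := odot) (hk rfl) bswitch_bijective.injective).2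
    exact ⟨fun ⟨_, h₁, h₂⟩ => (hd _ _ (h₁.symm.trans h₂)).symm,
      fun h => ⟨_, rfl, h ▸ hk rfl _⟩⟩

/-- The colours of the ends of a strand with a kink on the left extend to a colouring. -/
lemma kinkLeft_extends [Finite X] {k : Kind} (hk : k = .double → IsPIAdequate X) (x₀ x₂ : X) :
    (∃ x₁, (⟨k, x₁, x₀, x₁, x₂⟩ : Node X).IsColored) ↔ x₀ = x₂ := by
  have hb := (diag_unique (A := utri) (B := otri) (diag (X := X)) switch_bijective.injective).1
  cases k <;> simp only [Node.IsColored]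
  · refine ⟨fun ⟨_, h₁, h₂⟩ => h₁.trans ((diag _).trans h₂.symm), fun h => ?_⟩
    -- The loop carries the preimage of `x₀` under the diagonal map.
    obtain ⟨x, hx⟩ := hb.surjective x₀
    exact ⟨x, hx.symm, h.symm.trans (hx.symm.trans (diag _))⟩
  · refine ⟨fun ⟨_, h₁, h₂⟩ => h₂.trans ((diag _).symm.trans h₁.symm), fun h => ?_⟩
    obtain ⟨x, hx⟩ := hb.surjective x₀
    exact ⟨x, h.symm.trans hx.symm, hx.symm.trans (diag _)⟩
  · have hd := (diag_unique (A := udot) (B := odot) (hk rfl) bswitch_bijective.injective).1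
    refine ⟨fun ⟨_, h₁, h₂⟩ => h₁.trans ((hk rfl _).trans h₂.symm), fun h => ?_⟩
    obtain ⟨x, hx⟩ := hd.surjective x₀
    exact ⟨x, hx.symm, h.symm.trans (hx.symm.trans (hk rfl _))⟩

end Moves

/-! ### Colourings of pieces and gluing. -/

namespace Fragment

variable {n : ℕ} (X : Type*) [Psyquandle X]

/-- The colourings of a piece of a diagram. -/
def Coloring (F : Fragment n) : Type _ :=
  {f : F.Arc → X // ∀ c, ((F.node c).map f).IsColored}

/-- The colourings of a piece of a diagram with given colours at the boundary points. -/
def BdryColoring (F : Fragment n) (b : Fin n → X) : Type _ :=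
  {f : F.Coloring X // ∀ i, f.1 (F.bdry i) = b i}

variable {X}

/-- Isomorphic pieces have the same colourings. -/
def Iso.coloring {F G : Fragment n} (e : F.Iso G) : F.Coloring X ≃ G.Coloring X where
  toFun f := ⟨f.1 ∘ e.arc.symm, fun c => by
    obtain ⟨c, rfl⟩ := e.crossing.surjective c
    rw [e.node_eq, Node.map_map, Function.comp_assoc, Equiv.symm_comp_self]
    exact f.2 c⟩
  invFun g := ⟨g.1 ∘ e.arc, fun c => by
    have := g.2 (e.crossing c)
    rwa [e.node_eq, Node.map_map] at this⟩
  left_inv f := Subtype.ext (by simp [Function.comp_assoc])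
  right_inv g := Subtype.ext (by simp [Function.comp_assoc])

/-- A colouring of two glued pieces consists of colourings that agree at the boundary. -/
def glueColoring (T C : Fragment n) :
    (glue T C).Coloring X ≃ Σ g : C.Coloring X, T.BdryColoring X (g.1 ∘ C.bdry) where
  toFun f := ⟨⟨fun a => f.1 (Quot.mk _ (Sum.inr a)), fun c => f.2 (Sum.inr c)⟩,
    ⟨fun a => f.1 (Quot.mk _ (Sum.inl a)), fun c => f.2 (Sum.inl c)⟩,
    fun i => congrArg f.1 (Quot.sound ⟨i, rfl, rfl⟩)⟩
  invFun p := ⟨Quot.lift (Sum.elim p.2.1.1 p.1.1) (by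
      rintro _ _ ⟨i, rfl, rfl⟩
      exact p.2.2 i), by
    rintro (c | c)
    · exact p.2.1.2 c
    · exact p.1.2 c⟩
  left_inv f := Subtype.ext (by
    funext a
    obtain ⟨a | a, rfl⟩ := Quot.exists_rep a <;> rfl)
  right_inv _ := rfl

variable (X) in
/-- The two pieces have equally many colourings, whatever the colours at the boundary are. -/
def SameColorings (T T' : Fragment n) : Prop :=
  ∀ b : Fin n → X, Nonempty (T.BdryColoring X b ≃ T'.BdryColoring X b)

/-- The colouring of the outside is kept, and the bijection for the boundary colours it induces is
applied inside. -/
lemma SameColorings.glue {T T' : Fragment n} (h : SameColorings X T T') (C : Fragment n) :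
    Nonempty ((Fragment.glue T C).Coloring X ≃ (Fragment.glue T' C).Coloring X) :=
  ⟨(glueColoring T C).trans ((Equiv.sigmaCongrRight fun g : C.Coloring X => (h (g.1 ∘ C.bdry)).some).trans
    (glueColoring T' C).symm)⟩

variable (X) in
/-- A colouring is determined by the colours at the boundary, and these satisfy `P`. -/
def Determines (T : Fragment n) (P : (Fin n → X) → Prop) : Prop :=
  ∀ b, Subsingleton (T.BdryColoring X b) ∧ (Nonempty (T.BdryColoring X b) ↔ P b)

lemma Determines.sameColorings {T T' : Fragment n} {P P' : (Fin n → X) → Prop}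
    (h : T.Determines X P) (h' : T'.Determines X P') (hP : ∀ b, P b ↔ P' b) :
    SameColorings X T T' := by
  intro b
  have := (h b).1
  have := (h' b).1
  by_cases hb : P b
  · obtain ⟨x⟩ := (h b).2.2 hb
    obtain ⟨y⟩ := (h' b).2.2 ((hP b).1 hb)
    exact ⟨equivOfSubsingletonOfSubsingleton (fun _ => y) (fun _ => x)⟩
  · have h₁ := fun x => hb ((h b).2.1 ⟨x⟩)
    have h₂ := fun x => hb ((hP b).2 ((h' b).2.1 ⟨x⟩))
    exact ⟨equivOfSubsingletonOfSubsingleton (fun x => (h₁ x).elim) (fun x => (h₂ x).elim)⟩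

end Fragment

/-! ### Colourings of the local pictures. -/

section Local

open Fragment

variable {X : Type*} [Psyquandle X]

lemma determines_ofTable {n m k : ℕ} {node : Fin k → Node (Fin m)} {bdry : Fin n → Fin m}
    {P : (Fin n → X) → Prop}
    (hu : ∀ f g : Fin m → X, (∀ c, ((node c).map f).IsColored) →
      (∀ c, ((node c).map g).IsColored) → (∀ i, f (bdry i) = g (bdry i)) → ∀ a, f a = g a)
    (he : ∀ b, (∃ f : Fin m → X, (∀ c, ((node c).map f).IsColored) ∧ ∀ i, f (bdry i) = b i) ↔
      P b) :
    (ofTable m k node bdry).Determines X P := by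
  refine fun b => ⟨⟨fun f g => Subtype.ext (Subtype.ext (funext ?_))⟩, ?_⟩
  · exact hu _ _ f.1.2 g.1.2 fun i => (f.2 i).trans (g.2 i).symm
  · rw [← he]
    exact ⟨fun ⟨f⟩ => ⟨f.1.1, f.1.2, f.2⟩, fun ⟨f, h₁, h₂⟩ => ⟨⟨⟨f, h₁⟩, h₂⟩⟩⟩

lemma strand_determines : strand.Determines X (fun b => b 0 = b 1) := by
  refine determines_ofTable ?_ ?_
  · intro f g _ _ h
    simpa [Fin.forall_fin_succ] using h
  · intro b
    simp only [Fin.forall_fin_succ, IsEmpty.forall_iff, true_and]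
    constructor
    · rintro ⟨f, h₁, h₂, -⟩
      exact h₁.symm.trans h₂
    · intro h
      exact ⟨fun _ => b 0, rfl, h, trivial⟩

lemma twoStrands_determines :
    twoStrands.Determines X (fun b => b 0 = b 2 ∧ b 1 = b 3) := by
  refine determines_ofTable ?_ ?_
  · intro f g _ _ h
    simp [Fin.forall_fin_succ] at h ⊢
    exact ⟨h.1, h.2.1⟩
  · intro b
    simp only [Fin.forall_fin_succ, IsEmpty.forall_iff, true_and]
    constructor
    · rintro ⟨f, h₁, h₂, h₃, h₄, -⟩
      exact ⟨h₁.symm.trans h₃, h₂.symm.trans h₄⟩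
    · rintro ⟨h, h'⟩
      exact ⟨![b 0, b 1], rfl, rfl, h, h', trivial⟩

lemma kinkRight_determines (k : Kind) : (kinkRight k).Determines X
    (fun b => ∃ x, (⟨k, b 0, x, b 1, x⟩ : Node X).IsColored) := by
  refine determines_ofTable ?_ ?_
  · intro f g hf hg h
    have h₀ : f 0 = g 0 := h 0
    have h₂ : f 2 = g 2 := h 1
    have hf : (⟨k, f 0, f 1, f 2, f 1⟩ : Node X).IsColored := hf 0
    have hg : (⟨k, g 0, g 1, g 2, g 1⟩ : Node X).IsColored := hg 0
    rw [h₀, h₂] at hf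
    have h₁ : f 1 = g 1 := by
      cases k <;> simp only [Node.IsColored] at hf hg <;> exact hf.1.trans hg.1.symm
    simp [Fin.forall_fin_succ, h₀, h₁, h₂]
  · intro b
    constructor
    · rintro ⟨f, hf, h⟩
      have hf : (⟨k, f 0, f 1, f 2, f 1⟩ : Node X).IsColored := hf 0
      exact ⟨f 1, (h 0 : f 0 = b 0) ▸ (h 1 : f 2 = b 1) ▸ hf⟩
    · rintro ⟨x, hx⟩
      refine ⟨![b 0, x, b 1], fun c => ?_, fun i => ?_⟩
      · fin_cases c; exact hx
      · fin_cases i <;> rfl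

lemma kinkLeft_determines [Finite X] {k : Kind} (hk : k = .double → IsPIAdequate X) :
    (kinkLeft k).Determines X
      (fun b => ∃ x, (⟨k, x, b 0, x, b 1⟩ : Node X).IsColored) := by
  refine determines_ofTable ?_ ?_
  · intro f g hf hg h
    have h₀ : f 0 = g 0 := h 0
    have h₂ : f 2 = g 2 := h 1
    have hf : (⟨k, f 1, f 0, f 1, f 2⟩ : Node X).IsColored := hf 0
    have hg : (⟨k, g 1, g 0, g 1, g 2⟩ : Node X).IsColored := hg 0
    rw [h₀, h₂] at hf
    -- Here the loop colour enters both equations as a repeated argument, so recovering it needs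
    -- injectivity of the diagonal map.
    have hb := (diag_unique (A := utri) (B := otri) (diag (X := X)) switch_bijective.injective).1
    have h₁ : f 1 = g 1 := by
      cases k <;> simp only [Node.IsColored] at hf hg
      · exact hb.injective (hf.1.symm.trans hg.1)
      · exact hb.injective (hf.1.symm.trans hg.1)
      · exact (diag_unique (A := udot) (B := odot) (hk rfl)
          bswitch_bijective.injective).1.injective (hf.1.symm.trans hg.1)
    simp [Fin.forall_fin_succ, h₀, h₁, h₂]
  · intro b
    constructor
    · rintro ⟨f, hf, h⟩
      have hf : (⟨k, f 1, f 0, f 1, f 2⟩ : Node X).IsColored := hf 0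
      exact ⟨f 1, (h 0 : f 0 = b 0) ▸ (h 1 : f 2 = b 1) ▸ hf⟩
    · rintro ⟨x, hx⟩
      refine ⟨![b 0, x, b 1], fun c => ?_, fun i => ?_⟩
      · fin_cases c; exact hx
      · fin_cases i <;> rfl

lemma twist_determines (p q : Pass) (r s : Bool) : (twist p q r s).Determines X
    (fun b => TwistExtends p q r s (b 0) (b 1) (b 2) (b 3)) := by
  have key (f : Fin 6 → X) : (∀ c : Fin 2, ((![Node.meet p r s 0 1 2 3,
      Node.meet q s r 3 2 5 4] c).map f).IsColored) ↔
      Meets p r s (f 0) (f 1) (f 2) (f 3) ∧ Meets q s r (f 3) (f 2) (f 5) (f 4) := by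
    simp [Fin.forall_fin_two, Node.map_meet, Meets]
  refine determines_ofTable ?_ ?_
  · intro f g hf hg h
    obtain ⟨f₁, f₂⟩ := (key f).1 hf
    obtain ⟨g₁, g₂⟩ := (key g).1 hg
    have h₀ : f 0 = g 0 := h 0
    have h₁ : f 1 = g 1 := h 1
    rw [h₀, h₁] at f₁
    obtain ⟨h₂, h₃⟩ := f₁.unique g₁
    rw [h₂, h₃] at f₂
    obtain ⟨h₅, h₄⟩ := f₂.unique g₂
    intro a
    fin_cases a
    exacts [h₀, h₁, h₂, h₃, h₄, h₅]
  · intro b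
    constructor
    · rintro ⟨f, hf, h⟩
      rw [← h 0, ← h 1, ← h 2, ← h 3]
      exact ⟨_, _, (key f).1 hf⟩
    · rintro ⟨x₂, x₃, h⟩
      refine ⟨![b 0, b 1, x₂, x₃, b 2, b 3], (key _).2 h, fun i => ?_⟩
      fin_cases i <;> rfl

lemma triangle_determines (h : Fin 3 → ℕ) (r : Fin 3 → Bool) : (triangle h r).Determines X
    (fun b => TriangleExtends h r (b 0) (b 1) (b 2) (b 3) (b 4) (b 5)) := by
  have key (f : Fin 9 → X) : (∀ c : Fin 3,
      ((![Node.meet (Pass.ofHeights (h 0) (h 1)) (r 0) (r 1) 0 1 3 4,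
        Node.meet (Pass.ofHeights (h 0) (h 2)) (r 0) (r 2) 3 2 6 5,
        Node.meet (Pass.ofHeights (h 1) (h 2)) (r 1) (r 2) 4 5 7 8] c).map f).IsColored) ↔
      Meets (Pass.ofHeights (h 0) (h 1)) (r 0) (r 1) (f 0) (f 1) (f 3) (f 4) ∧
      Meets (Pass.ofHeights (h 0) (h 2)) (r 0) (r 2) (f 3) (f 2) (f 6) (f 5) ∧
      Meets (Pass.ofHeights (h 1) (h 2)) (r 1) (r 2) (f 4) (f 5) (f 7) (f 8) := by
    simp [Fin.forall_fin_succ, Node.map_meet, Meets]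
  refine determines_ofTable ?_ ?_
  · intro f g hf hg e
    obtain ⟨f₁, f₂, f₃⟩ := (key f).1 hf
    obtain ⟨g₁, g₂, g₃⟩ := (key g).1 hg
    have e₀ : f 0 = g 0 := e 0
    have e₁ : f 1 = g 1 := e 1
    have e₂ : f 2 = g 2 := e 2
    rw [e₀, e₁] at f₁
    obtain ⟨e₃, e₄⟩ := f₁.unique g₁
    rw [e₂, e₃] at f₂
    obtain ⟨e₆, e₅⟩ := f₂.unique g₂
    rw [e₄, e₅] at f₃
    obtain ⟨e₇, e₈⟩ := f₃.unique g₃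
    intro a
    fin_cases a
    exacts [e₀, e₁, e₂, e₃, e₄, e₅, e₆, e₇, e₈]
  · intro b
    constructor
    · rintro ⟨f, hf, e⟩
      rw [← e 0, ← e 1, ← e 2, ← e 3, ← e 4, ← e 5]
      exact ⟨_, _, _, (key f).1 hf⟩
    · rintro ⟨x₃, x₄, x₅, e⟩
      refine ⟨![b 0, b 1, b 2, x₃, x₄, x₅, b 3, b 4, b 5], (key _).2 e, fun i => ?_⟩
      fin_cases i <;> rfl

lemma triangle'_determines (h : Fin 3 → ℕ) (r : Fin 3 → Bool) : (triangle' h r).Determines X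
    (fun b => TriangleExtends' h r (b 0) (b 1) (b 2) (b 3) (b 4) (b 5)) := by
  have key (f : Fin 9 → X) : (∀ c : Fin 3,
      ((![Node.meet (Pass.ofHeights (h 1) (h 2)) (r 1) (r 2) 1 2 4 5,
        Node.meet (Pass.ofHeights (h 0) (h 2)) (r 0) (r 2) 0 5 3 8,
        Node.meet (Pass.ofHeights (h 0) (h 1)) (r 0) (r 1) 3 4 6 7] c).map f).IsColored) ↔
      Meets (Pass.ofHeights (h 1) (h 2)) (r 1) (r 2) (f 1) (f 2) (f 4) (f 5) ∧
      Meets (Pass.ofHeights (h 0) (h 2)) (r 0) (r 2) (f 0) (f 5) (f 3) (f 8) ∧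
      Meets (Pass.ofHeights (h 0) (h 1)) (r 0) (r 1) (f 3) (f 4) (f 6) (f 7) := by
    simp [Fin.forall_fin_succ, Node.map_meet, Meets]
  refine determines_ofTable ?_ ?_
  · intro f g hf hg e
    obtain ⟨f₁, f₂, f₃⟩ := (key f).1 hf
    obtain ⟨g₁, g₂, g₃⟩ := (key g).1 hg
    have e₀ : f 0 = g 0 := e 0
    have e₁ : f 1 = g 1 := e 1
    have e₂ : f 2 = g 2 := e 2
    -- In this picture strands `1` and `2` meet first, so the colours propagate from that crossing.
    rw [e₁, e₂] at f₁
    obtain ⟨e₄, e₅⟩ := f₁.unique g₁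
    rw [e₀, e₅] at f₂
    obtain ⟨e₃, e₈⟩ := f₂.unique g₂
    rw [e₃, e₄] at f₃
    obtain ⟨e₆, e₇⟩ := f₃.unique g₃
    intro a
    fin_cases a
    exacts [e₀, e₁, e₂, e₃, e₄, e₅, e₆, e₇, e₈]
  · intro b
    constructor
    · rintro ⟨f, hf, e⟩
      rw [← e 0, ← e 1, ← e 2, ← e 3, ← e 4, ← e 5]
      exact ⟨_, _, _, (key f).1 hf⟩
    · rintro ⟨x₃, x₄, x₅, e⟩
      refine ⟨![b 0, b 1, b 2, x₃, x₄, x₅, b 3, b 4, b 5], (key _).2 e, fun i => ?_⟩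
      fin_cases i <;> rfl

lemma kinkRight_sameColorings [Finite X] {k : Kind} (hk : k = .double → IsPIAdequate X) :
    SameColorings X strand (kinkRight k) :=
  strand_determines.sameColorings (kinkRight_determines k)
    fun _ => (kinkRight_extends hk _ _).symm

lemma kinkLeft_sameColorings [Finite X] {k : Kind} (hk : k = .double → IsPIAdequate X) :
    SameColorings X strand (kinkLeft k) :=
  strand_determines.sameColorings (kinkLeft_determines hk)
    fun _ => (kinkLeft_extends hk _ _).symm

lemma SingularLocalMove.sameColorings [Finite X] {n : ℕ} {T T' : Fragment n}
    (H : SingularLocalMove T T') : SameColorings X T T' := by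
  cases H with
  | rI_right k hk => exact kinkRight_sameColorings fun h => absurd h hk
  | rI_left k hk => exact kinkLeft_sameColorings fun h => absurd h hk
  | rII p hp r s =>
    exact twoStrands_determines.sameColorings (twist_determines p p.swap r s)
      fun b => (twistExtends_swap hp r s _ _ _ _).symm
  | rIII h hh r =>
    refine (triangle_determines h r).sameColorings (triangle'_determines h r)
      fun b => triangleInvariant h (fun e => ?_) r _ _ _ _ _ _
    exact absurd (hh e.1) (by decide)
  | sII p hp r s =>
    exact (twist_determines p .flat r s).sameColorings (twist_determines .flat p r s)
      fun b => twistExtends_slide hp r s _ _ _ _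
  | sIII h hh r =>
    refine (triangle_determines h r).sameColorings (triangle'_determines h r)
      fun b => triangleInvariant h (fun e => ?_) r _ _ _ _ _ _
    have : Set.range h ⊆ {h 0} := by
      rintro _ ⟨i, rfl⟩
      fin_cases i
      exacts [rfl, e.1.symm, (e.1.trans e.2).symm]
    have := Set.ncard_le_ncard this
    rw [hh, Set.ncard_singleton] at this
    omega

lemma PseudoLocalMove.sameColorings [Finite X] (hX : IsPIAdequate X) {n : ℕ}
    {T T' : Fragment n} (H : PseudoLocalMove T T') : SameColorings X T T' := by
  cases H with
  | ofSingular h => exact h.sameColorings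
  | pI_right => exact kinkRight_sameColorings fun _ => hX
  | pI_left => exact kinkLeft_sameColorings fun _ => hX

end Local

/-! ### From local pictures to diagrams and links. -/

namespace Diagram

variable {X : Type*} [Psyquandle X]

lemma numColorings_eq_of_iso {D D' : Diagram} (e : D.toFragment.Iso D'.toFragment) :
    D.numColorings X = D'.numColorings X :=
  Nat.card_congr (e.coloring (X := X))

lemma Replace.numColorings_eq {R : {n : ℕ} → Fragment n → Fragment n → Prop}
    (hR : ∀ {n : ℕ} {T T' : Fragment n}, R T T' → Fragment.SameColorings X T T')
    {D D' : Diagram} (h : Replace R D D') : D.numColorings X = D'.numColorings X := by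
  obtain ⟨n, T, T', C, hT, ⟨e⟩, ⟨e'⟩⟩ := h
  obtain ⟨E⟩ := (hR hT).glue C
  exact Nat.card_congr ((e.coloring (X := X)).trans (E.trans (e'.coloring (X := X)).symm))

end Diagram

lemma existsUnique_quot_invariant {α : Type*} {β : Type*} {R : α → α → Prop} {f : α → β}
    (h : ∀ a b, R a b → f a = f b) : ∃! Φ : Quot R → β, ∀ a, Φ (Quot.mk R a) = f a :=
  ⟨Quot.lift f h, fun _ => rfl, fun Ψ hΨ => funext fun q => by
    obtain ⟨a, rfl⟩ := Quot.exists_rep q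
    exact hΨ a⟩

end SingularLink

/-- The psyquandle counting invariant of oriented singular links, and of oriented pseudolinks if
`X` is pI-adequate. -/
theorem mainTheorem1 (X : Type*) [Finite X] [Psyquandle X] :
    ((∀ D D' : SingularLink.Diagram, SingularLink.SingularMove D D' →
        D.numColorings X = D'.numColorings X) ∧
      ∃! Φ : SingularLink.OrientedSingularLink → ℕ,
        ∀ D : SingularLink.Diagram, Φ D.singularLink = D.numColorings X) ∧
    (Psyquandle.IsPIAdequate X →
      (∀ D D' : SingularLink.Diagram, SingularLink.PseudoMove D D' →
        D.numColorings X = D'.numColorings X) ∧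
      ∃! Φ : SingularLink.OrientedPseudolink → ℕ,
        ∀ D : SingularLink.Diagram, Φ D.pseudolink = D.numColorings X) := by
  have hs : ∀ D D' : SingularLink.Diagram, SingularLink.SingularMove D D' →
      D.numColorings X = D'.numColorings X := by
    rintro D D' (⟨⟨e⟩⟩ | h)
    · exact SingularLink.Diagram.numColorings_eq_of_iso e
    · exact h.numColorings_eq SingularLink.SingularLocalMove.sameColorings
  refine ⟨⟨hs, SingularLink.existsUnique_quot_invariant hs⟩, fun hX => ?_⟩
  have hp : ∀ D D' : SingularLink.Diagram, SingularLink.PseudoMove D D' →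
      D.numColorings X = D'.numColorings X := by
    rintro D D' (⟨⟨e⟩⟩ | h)
    · exact SingularLink.Diagram.numColorings_eq_of_iso e
    · exact h.numColorings_eq (SingularLink.PseudoLocalMove.sameColorings hX)
  exact ⟨hp, SingularLink.existsUnique_quot_invariant hp⟩
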